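/- Let $M$ be a connected orientable smooth ($C^\infty$) manifold of dimension $n$, possibly with boundary or corners, and let $K\subset M$ be a nonempty smoothly embedded submanifold of dimension $n-1$ (possibly with boundary or corners) which is a closed subset of $M$; that is, $K$ is the image of a nonempty smooth $(n-1)$-manifold under a smooth closed topological embedding with injective differentials. Fix an orientation of $M$ and let $\mathrm{Diff}^1_+(M,K)$ be the group, under composition, of orientation-preserving $C^1$ self-diffeomorphisms of $M$ that fix every point of $K$. Then $\mathrm{Diff}^1_+(M,K)$ is locally indicable: every nontrivial finitely generated subgroup of it admits a surjective homomorphism onto $\mathbb Z$. Hence it is left orderable: it admits a total order $\prec$ such that, for all $f,g,h$, $g\prec h$ if and only if $fg\prec fh$. -/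

import Mathlib

open scoped Manifold ContDiff Topology

/-- A group is left orderable if it carries a total order that is invariant under left
multiplication. -/
def LeftOrderable (G : Type*) [Group G] : Prop :=
  ∃ _ : LinearOrder G, ∀ f g h : G, g < h ↔ f * g < f * h

/-- A group is locally indicable if every nontrivial finitely generated subgroup admits a
surjective homomorphism onto `ℤ`. -/
def LocallyIndicable (G : Type*) [Group G] : Prop :=
  ∀ H : Subgroup G, H.FG → H ≠ ⊥ →
    ∃ φ : H →* Multiplicative ℤ, Function.Surjective φ

section Manifold

variable {E : Type*} [NormedAddCommGroup E] [NormedSpace ℝ E]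
  {H : Type*} [TopologicalSpace H] (I : ModelWithCorners ℝ E H)
  (M : Type*) [TopologicalSpace M] [ChartedSpace H M]

/-- An orientation of a manifold: an orientation of every tangent space, continuous in the
sense that it is locally constant in the trivializations of the tangent bundle given by
charts. -/
structure ManifoldOrientation [IsManifold I 1 M] where
  /-- the orientation of the tangent space at a point -/
  orientationAt : ∀ x : M, Orientation ℝ (TangentSpace I x) (Fin (Module.finrank ℝ E))
  locally_constant : ∀ p : M, ∃ θ : Orientation ℝ E (Fin (Module.finrank ℝ E)),
    ∀ᶠ x in 𝓝 p, ∀ hx : x ∈ (trivializationAt E (TangentSpace I : M → Type _) p).baseSet,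
      Orientation.map (Fin (Module.finrank ℝ E))
        ((trivializationAt E (TangentSpace I : M → Type _) p).continuousLinearEquivAt
          ℝ x hx).toLinearEquiv (orientationAt x) = θ

variable {I M}

/-- The `C^k` self-diffeomorphisms of a manifold form a group under composition. -/
noncomputable instance diffeomorphGroup {k : ℕ∞ω} : Group (M ≃ₘ^k⟮I, I⟯ M) where
  mul f g := g.trans f
  one := Diffeomorph.refl I M k
  inv f := f.symm
  mul_assoc _ _ _ := Diffeomorph.ext fun _ => rfl
  one_mul _ := Diffeomorph.ext fun _ => rfl
  mul_one _ := Diffeomorph.ext fun _ => rfl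
  inv_mul_cancel f := Diffeomorph.ext fun x => f.symm_apply_apply x

theorem diffeomorph_one_apply {k : ℕ∞ω} (x : M) : (1 : M ≃ₘ^k⟮I, I⟯ M) x = x := rfl

theorem diffeomorph_mul_apply {k : ℕ∞ω} (f g : M ≃ₘ^k⟮I, I⟯ M) (x : M) :
    (f * g) x = f (g x) := rfl

theorem diffeomorph_inv_apply_self {k : ℕ∞ω} (f : M ≃ₘ^k⟮I, I⟯ M) (x : M) :
    f⁻¹ (f x) = x := f.symm_apply_apply x

theorem diffeomorph_apply_inv_self {k : ℕ∞ω} (f : M ≃ₘ^k⟮I, I⟯ M) (x : M) :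
    f (f⁻¹ x) = x := f.apply_symm_apply x

/-- A `C^1` self-diffeomorphism preserves the orientation `o` if its derivative at every point
`x` carries the orientation at `x` to the orientation at the image of `x`. -/
def ManifoldOrientation.IsPreservedBy [IsManifold I 1 M] (o : ManifoldOrientation I M)
    (f : M ≃ₘ^1⟮I, I⟯ M) : Prop :=
  ∀ x : M, Orientation.map (Fin (Module.finrank ℝ E))
    (f.mfderivToContinuousLinearEquiv one_ne_zero x).toLinearEquiv (o.orientationAt x)
      = o.orientationAt (f x)

/-- Chain rule for the action of diffeomorphisms on orientations of tangent spaces. -/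
theorem orientation_map_mul [IsManifold I 1 M] {ι : Type*} (f g : M ≃ₘ^1⟮I, I⟯ M) (x : M)
    (u : Orientation ℝ (TangentSpace I x) ι) :
    Orientation.map ι ((f * g).mfderivToContinuousLinearEquiv one_ne_zero x).toLinearEquiv u
      = Orientation.map ι (f.mfderivToContinuousLinearEquiv one_ne_zero (g x)).toLinearEquiv
        (Orientation.map ι (g.mfderivToContinuousLinearEquiv one_ne_zero x).toLinearEquiv u) := by
  have key : ((f * g).mfderivToContinuousLinearEquiv one_ne_zero x).toLinearEquiv
      = (g.mfderivToContinuousLinearEquiv one_ne_zero x).toLinearEquiv.trans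
        (f.mfderivToContinuousLinearEquiv one_ne_zero (g x)).toLinearEquiv := by
    ext v
    change mfderiv I I (f ∘ g) x v = mfderiv I I f (g x) (mfderiv I I g x v)
    rw [mfderiv_comp x (f.mdifferentiable one_ne_zero _) (g.mdifferentiable one_ne_zero _)]
    rfl
  rw [key]
  induction u using Module.Ray.ind with
  | h v hv => rfl

theorem orientation_map_one [IsManifold I 1 M] {ι : Type*} (x : M)
    (u : Orientation ℝ (TangentSpace I x) ι) :
    Orientation.map ι ((1 : M ≃ₘ^1⟮I, I⟯ M).mfderivToContinuousLinearEquiv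
      one_ne_zero x).toLinearEquiv u = u := by
  have key : ((1 : M ≃ₘ^1⟮I, I⟯ M).mfderivToContinuousLinearEquiv one_ne_zero x).toLinearEquiv
      = LinearEquiv.refl ℝ (TangentSpace I x) := by
    ext v
    change mfderiv I I (id : M → M) x v = v
    rw [mfderiv_id]
    rfl
  rw [key]
  exact Equiv.congr_fun (Orientation.map_refl (R := ℝ) (M := TangentSpace I x) (ι := ι)) u

theorem ManifoldOrientation.isPreservedBy_inv [IsManifold I 1 M]
    (o : ManifoldOrientation I M) {f : M ≃ₘ^1⟮I, I⟯ M}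
    (hf : o.IsPreservedBy f) : o.IsPreservedBy f⁻¹ := by
  intro y
  obtain ⟨x, rfl⟩ := f.surjective y
  have h1 : ∀ g : M ≃ₘ^1⟮I, I⟯ M, g = 1 →
      Orientation.map _ (g.mfderivToContinuousLinearEquiv one_ne_zero x).toLinearEquiv
        (o.orientationAt x) = o.orientationAt (g x) := by
    rintro g rfl
    exact orientation_map_one x _
  have h2 := h1 (f⁻¹ * f) (inv_mul_cancel f)
  rw [orientation_map_mul, hf x] at h2
  exact h2

/-- `Diff^1_+(M, K)`: the group of `C^1` self-diffeomorphisms of `M`, oriented by `o`, that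
preserve the orientation and fix `K` pointwise. -/
noncomputable def orientedDiffFixing [IsManifold I 1 M] (o : ManifoldOrientation I M) (K : Set M) :
    Subgroup (M ≃ₘ^1⟮I, I⟯ M) where
  carrier := {f | o.IsPreservedBy f ∧ ∀ x ∈ K, f x = x}
  one_mem' := ⟨fun x => orientation_map_one x _, fun _ _ => rfl⟩
  mul_mem' := fun {f g} hf hg => ⟨fun x => by
    rw [orientation_map_mul, hg.1 x, hf.1 (g x)]
    rfl, fun x hx => by
    rw [diffeomorph_mul_apply, hg.2 x hx, hf.2 x hx]⟩
  inv_mem' := fun {f} hf => ⟨o.isPreservedBy_inv hf.1, fun x hx => by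
    conv_lhs => rw [← hf.2 x hx]
    exact diffeomorph_inv_apply_self f x⟩

end Manifold

section GroupTheory

/-- A finitely generated group with a nontrivial homomorphism to a real vector space maps
onto `ℤ`. -/
theorem exists_surjective_hom_int_of_hom_ne_zero {G : Type*} [Group G] [Group.FG G]
    {V : Type*} [AddCommGroup V] [Module ℝ V] (f : G → V)
    (hf : ∀ g h, f (g * h) = f g + f h) {g : G} (hg : f g ≠ 0) :
    ∃ φ : G →* Multiplicative ℤ, Function.Surjective φ := by
  let F : Additive G →+ V := AddMonoidHom.mk' f hf
  let R := F.range
  have : AddGroup.FG R := AddGroup.fg_range F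
  have : Module.Finite ℤ R := Module.Finite.iff_addGroup_fg.2 inferInstance
  let _ : Module ℚ V := Module.compHom V (algebraMap ℚ ℝ)
  have : IsAddTorsionFree V := .of_module_rat V
  let b := Module.Free.chooseBasis ℤ R
  have hne : F.rangeRestrict (Additive.ofMul g) ≠ 0 := fun h => hg (congrArg Subtype.val h)
  obtain ⟨i, -⟩ : ∃ i, b.repr (F.rangeRestrict (Additive.ofMul g)) i ≠ 0 := by
    by_contra! h
    exact hne (b.repr.map_eq_zero_iff.1 (Finsupp.ext h))
  let c : R →+ ℤ := (b.coord i).toAddMonoidHom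
  refine ⟨AddMonoidHom.toMultiplicativeRight (c.comp F.rangeRestrict), fun m => ?_⟩
  obtain ⟨x, hx⟩ := F.rangeRestrict_surjective (Multiplicative.toAdd m • b i)
  refine ⟨x.toMul, ?_⟩
  change Multiplicative.ofAdd (c (F.rangeRestrict x)) = m
  rw [hx]
  simp [c]

/-- In a locally indicable group, nonidentity elements of a finite set can be replaced by their
inverses so that no product of the resulting elements is trivial. -/
theorem LocallyIndicable.exists_signs {G : Type*} [Group G] (hG : LocallyIndicable G)
    (S : Finset G) (hS : (1 : G) ∉ S) :
    ∃ P : Subsemigroup G, (1 : G) ∉ P ∧ ∀ x ∈ S, x ∈ P ∨ x⁻¹ ∈ P := by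
  classical
  induction S using Finset.strongInduction with
  | H S ih =>
    rcases S.eq_empty_or_nonempty with rfl | ⟨s, hs⟩
    · exact ⟨⊥, fun h => h, by simp⟩
    set H : Subgroup G := Subgroup.closure (S : Set G) with hH
    have hmem : ∀ x ∈ S, x ∈ H := fun x hx => Subgroup.subset_closure hx
    obtain ⟨φ, hφ⟩ := hG H ⟨S, rfl⟩ fun h => hS <| by
      have := hmem s hs
      rw [h, Subgroup.mem_bot] at this
      exact this ▸ hs
    let T := S.filter fun x => ∃ h : x ∈ H, φ ⟨x, h⟩ = 1
    have hT : T ⊂ S := by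
      refine Finset.filter_ssubset.2 ?_
      by_contra! hall
      have hker : ∀ x (hx : x ∈ H), φ ⟨x, hx⟩ = 1 := by
        intro x hx
        induction hx using Subgroup.closure_induction with
        | mem x hx => exact (hall x hx).2
        | one => exact φ.map_one
        | mul x y hx hy h1 h2 =>
          have := φ.map_mul ⟨x, hx⟩ ⟨y, hy⟩
          rw [h1, h2, one_mul] at this
          exact this
        | inv x hx h1 =>
          have := φ.map_inv ⟨x, hx⟩
          rw [h1, inv_one] at this
          exact this
      obtain ⟨⟨x, hx⟩, hx'⟩ := hφ (Multiplicative.ofAdd 1)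
      rw [hker x hx] at hx'
      exact absurd hx' (by decide)
    obtain ⟨P, hP1, hP⟩ := ih T hT fun h => hS (hT.1 h)
    let Q : Subsemigroup G :=
      { carrier := {x | ∃ h : x ∈ H, 1 < φ ⟨x, h⟩ ∨ (φ ⟨x, h⟩ = 1 ∧ x ∈ P)}
        mul_mem' := by
          rintro x y ⟨hx, hx'⟩ ⟨hy, hy'⟩
          refine ⟨H.mul_mem hx hy, ?_⟩
          have e : φ ⟨x * y, H.mul_mem hx hy⟩ = φ ⟨x, hx⟩ * φ ⟨y, hy⟩ :=
            φ.map_mul ⟨x, hx⟩ ⟨y, hy⟩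
          rw [e]
          rcases hx' with hx' | ⟨hx', hxP⟩ <;> rcases hy' with hy' | ⟨hy', hyP⟩
          · exact Or.inl (one_lt_mul'' hx' hy')
          · left; rwa [hy', mul_one]
          · left; rwa [hx', one_mul]
          · right; exact ⟨by rw [hx', hy', one_mul], P.mul_mem hxP hyP⟩ }
    have hinv : ∀ x (hx : x ∈ H), φ ⟨x⁻¹, H.inv_mem hx⟩ = (φ ⟨x, hx⟩)⁻¹ := fun x hx =>
      φ.map_inv ⟨x, hx⟩
    refine ⟨Q, ?_, fun x hx => ?_⟩
    · rintro ⟨h, h' | h'⟩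
      · have : φ ⟨1, h⟩ = 1 := φ.map_one
        exact absurd h' (this ▸ lt_irrefl _)
      · exact hP1 h'.2
    · rcases lt_trichotomy (φ ⟨x, hmem x hx⟩) 1 with h | h | h
      · exact Or.inr ⟨H.inv_mem (hmem x hx), Or.inl (by rw [hinv x (hmem x hx)]; exact one_lt_inv'.2 h)⟩
      · refine (hP x (Finset.mem_filter.2 ⟨hx, hmem x hx, h⟩)).imp
          (fun hxP => ⟨hmem x hx, Or.inr ⟨h, hxP⟩⟩)
          (fun hxP => ⟨H.inv_mem (hmem x hx), Or.inr ⟨?_, hxP⟩⟩)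
        rw [hinv x (hmem x hx), h, inv_one]
      · exact Or.inl ⟨hmem x hx, Or.inl h⟩

/-- A group with a positive cone is left orderable. -/
theorem leftOrderable_of_cone {G : Type*} [Group G] (P : Subsemigroup G) (h1 : (1 : G) ∉ P)
    (hP : ∀ x, x ≠ 1 → x ∈ P ∨ x⁻¹ ∈ P) : LeftOrderable G := by
  classical
  let _ : LinearOrder G :=
    { le := fun a b => a = b ∨ a⁻¹ * b ∈ P
      le_refl := fun a => Or.inl rfl
      le_trans := by
        rintro a b c (rfl | h) (rfl | h')
        · exact Or.inl rfl
        · exact Or.inr h'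
        · exact Or.inr h
        · exact Or.inr (by simpa [mul_assoc] using P.mul_mem h h')
      le_antisymm := by
        rintro a b (rfl | h) (h' | h')
        · rfl
        · rfl
        · exact h'.symm
        · exact absurd (by simpa [mul_assoc] using P.mul_mem h h') h1
      le_total := fun a b => by
        by_cases hab : a = b
        · exact Or.inl (Or.inl hab)
        · refine (hP (a⁻¹ * b) fun h => hab (inv_mul_eq_one.1 h)).imp Or.inr fun h => Or.inr ?_
          simpa using h
      toDecidableLE := Classical.decRel _ }
  have hle : ∀ a b : G, a ≤ b ↔ a = b ∨ a⁻¹ * b ∈ P := fun _ _ => Iff.rfl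
  refine ⟨inferInstance, fun f g h => ?_⟩
  rw [lt_iff_not_ge, lt_iff_not_ge, hle, hle]
  simp [mul_assoc]

/-- The Burns–Hale theorem: locally indicable groups are left orderable. -/
theorem LocallyIndicable.leftOrderable {G : Type*} [Group G] (hG : LocallyIndicable G) :
    LeftOrderable G := by
  classical
  choose P hP1 hP using fun S : Finset G =>
    hG.exists_signs (S.erase 1) (Finset.notMem_erase 1 S)
  let U : Ultrafilter (Finset G) := Ultrafilter.of Filter.atTop
  have hU : (U : Filter (Finset G)) ≤ Filter.atTop := Ultrafilter.of_le _
  let Q : Subsemigroup G :=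
    { carrier := {x | ∀ᶠ S in (U : Filter (Finset G)), x ∈ P S}
      mul_mem' := fun hx hy => by
        filter_upwards [hx, hy] with S h h' using (P S).mul_mem h h' }
  refine leftOrderable_of_cone Q (fun h => ?_) fun x hx => ?_
  · obtain ⟨S, hS⟩ := Filter.Eventually.exists h
    exact hP1 S hS
  · refine Ultrafilter.eventually_or.1 ?_
    filter_upwards [hU (Filter.eventually_ge_atTop {x})] with S hS
    exact hP S x (Finset.mem_erase.2 ⟨hx, hS (Finset.mem_singleton_self x)⟩)

end GroupTheory

section Linear

/-- A group acting linearly on a finite-dimensional space, fixing a hyperplane pointwise and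
preserving orientation, has a nontrivial homomorphism to a real vector space unless it acts
trivially. -/
theorem exists_additive_of_fixes_hyperplane {G : Type*} [Group G] {E : Type*}
    [AddCommGroup E] [Module ℝ E] [FiniteDimensional ℝ E] (D : G → E →ₗ[ℝ] E)
    (hD : ∀ g h, D (g * h) = D g ∘ₗ D h) (hdet : ∀ g, 0 < LinearMap.det (D g))
    (W : Submodule ℝ E) (hW : Module.finrank ℝ W + 1 = Module.finrank ℝ E)
    (hfix : ∀ g, ∀ w ∈ W, D g w = w) {g₀ : G} (hg₀ : D g₀ ≠ LinearMap.id) :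
    (∃ f : G → ℝ, (∀ g h, f (g * h) = f g + f h) ∧ ∃ g, f g ≠ 0) ∨
    (∃ f : G → (E →ₗ[ℝ] E), (∀ g h, f (g * h) = f g + f h) ∧ ∃ g, f g ≠ 0) := by
  by_cases h1 : ∃ g, LinearMap.det (D g) ≠ 1
  · obtain ⟨g, hg⟩ := h1
    refine Or.inl ⟨fun g => Real.log (LinearMap.det (D g)), fun g h => ?_, g, fun h => ?_⟩
    · beta_reduce
      rw [hD, LinearMap.det_comp, Real.log_mul (hdet g).ne' (hdet h).ne']
    · exact hg (Real.eq_one_of_pos_of_log_eq_zero (hdet g) h)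
  push Not at h1
  refine Or.inr ⟨fun g => D g - LinearMap.id, fun g h => ?_, g₀, sub_ne_zero.2 hg₀⟩
  obtain ⟨e, he⟩ : ∃ e, e ∉ W := by
    by_contra! hall
    have : W = ⊤ := eq_top_iff.2 fun x _ => hall x
    rw [this, finrank_top] at hW
    omega
  obtain ⟨l, hle, hlW⟩ := Submodule.exists_dual_map_eq_bot_of_notMem he inferInstance
  have hlW' : ∀ w ∈ W, l w = 0 := fun w hw => by
    have : l w ∈ W.map l := ⟨w, hw, rfl⟩
    rwa [hlW] at this
  have hker : ∀ x, l x = 0 → x ∈ W := by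
    have hle' : W ≤ LinearMap.ker l := hlW'
    have hr := LinearMap.finrank_range_add_finrank_ker l
    have hr1 : Module.finrank ℝ (LinearMap.range l) ≠ 0 := by
      intro h0
      have := Submodule.finrank_eq_zero.1 h0
      rw [LinearMap.range_eq_bot] at this
      exact hle (by simp [this])
    have heq := Submodule.eq_of_le_of_finrank_le hle' (by omega)
    intro x hx
    rw [heq]
    exact hx
  have htv : ∀ g, D g = LinearMap.transvection ((l e)⁻¹ • l) (D g e - e) := by
    intro g
    ext x
    have hx : x - ((l e)⁻¹ * l x) • e ∈ W := hker _ (by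
      rw [map_sub, map_smul, smul_eq_mul]
      field_simp
      ring)
    have := hfix g _ hx
    rw [map_sub, map_smul, sub_eq_iff_eq_add] at this
    rw [this, LinearMap.transvection.apply, LinearMap.smul_apply, smul_eq_mul, smul_sub]
    abel
  have hl : ∀ g, D g e - e ∈ W := by
    intro g
    have := h1 g
    rw [htv g, LinearMap.transvection.det] at this
    refine hker _ ?_
    have h2 : (l e)⁻¹ * l (D g e - e) = 0 := by simpa using this
    exact (mul_eq_zero.1 h2).resolve_left (inv_ne_zero hle)
  have himg : ∀ h x, D h x - x ∈ W := by
    intro h x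
    rw [htv h, LinearMap.transvection.apply, add_sub_cancel_left]
    exact W.smul_mem _ (hl h)
  ext x
  have := hfix g _ (himg h x)
  rw [map_sub, sub_eq_iff_eq_add] at this
  simp only [hD, LinearMap.sub_apply, LinearMap.comp_apply, LinearMap.id_apply,
    LinearMap.add_apply, this]
  abel

end Linear

section Thurston

open Filter Asymptotics

/-- Near a point of a convex set, a `C^1` map minus its derivative there has arbitrarily small
Lipschitz constant. -/
theorem exists_lipschitzOnWith_sub_of_contDiffWithinAt {E : Type*} [NormedAddCommGroup E]
    [NormedSpace ℝ E] {s : Set E} (hs : Convex ℝ s) {x : E} (hx : x ∈ s)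
    (hu : UniqueDiffWithinAt ℝ s x) {a : E → E} (ha : ContDiffWithinAt ℝ 1 a s x)
    {A : E →L[ℝ] E} (hA : fderivWithin ℝ a s x = A) {ε : NNReal} (hε : 0 < ε) :
    ∃ t ∈ 𝓝[s] x, LipschitzOnWith ε (fun y => a y - A y) t := by
  have hb : ContDiffWithinAt ℝ 1 (fun y => a y - A y) s x :=
    ha.sub A.contDiff.contDiffWithinAt
  obtain ⟨t, ht, p, hp⟩ := hb 1 le_rfl
  obtain ⟨δ, hδ, hball⟩ := Metric.mem_nhdsWithin_iff.mp ht
  rw [Set.insert_eq_of_mem hx] at hball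
  have hxb : x ∈ Metric.ball x δ ∩ s := ⟨Metric.mem_ball_self hδ, hx⟩
  replace hp : HasFTaylorSeriesUpToOn 1 (fun y => a y - A y) p
      (insert x (Metric.ball x δ ∩ s)) := by
    rw [Set.insert_eq_of_mem hxb]
    exact hp.mono hball
  have hnhds : 𝓝[Metric.ball x δ ∩ s] x = 𝓝[s] x := by
    rw [Set.inter_comm]
    exact nhdsWithin_inter_of_mem' (mem_nhdsWithin_of_mem_nhds (Metric.ball_mem_nhds x hδ))
  have hder := hp.hasFDerivWithinAt one_ne_zero (Set.mem_insert x _)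
  rw [Set.insert_eq_of_mem hxb] at hder
  have hder' : HasFDerivWithinAt (fun y => a y - A y)
      (continuousMultilinearCurryFin1 ℝ E E (p x 1)) s x :=
    hder.mono_of_mem_nhdsWithin (hnhds ▸ self_mem_nhdsWithin)
  have hder0 : HasFDerivWithinAt (fun y => a y - A y) (0 : E →L[ℝ] E) s x := by
    have := (ha.differentiableWithinAt one_ne_zero).hasFDerivWithinAt.sub
      A.hasFDerivWithinAt
    rwa [hA, sub_self] at this
  have hp0 : p x 1 = 0 :=
    (continuousMultilinearCurryFin1 ℝ E E).map_eq_zero_iff.1 (hu.eq hder' hder0)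
  rw [← hnhds]
  exact hp.exists_lipschitzOnWith_of_nnnorm_lt ((convex_ball x δ).inter hs) ε
    (by rw [hp0, nnnorm_zero]; exact hε)

/-- Thurston stability for germs of local actions tangent to the identity along a filter: a group
with a finite generating set moving points frequently along the filter has a nontrivial
homomorphism to the ambient vector space. -/
theorem exists_additive_of_tangent_to_identity {G : Type*} [Group G] {E : Type*}
    [NormedAddCommGroup E] [NormedSpace ℝ E] [FiniteDimensional ℝ E] {L : Filter E}
    (S : Finset G) (hS : Subgroup.closure (S : Set G) = ⊤) (a : G → E → E)
    (hone : ∀ᶠ x in L, a 1 x = x)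
    (hmul : ∀ g h, ∀ᶠ x in L, a (g * h) x = a g (a h x))
    (htend : ∀ g, Tendsto (a g) L L)
    (hlip : ∀ g, ∀ ε : NNReal, 0 < ε → ∃ t ∈ L, LipschitzOnWith ε (fun x => a g x - x) t)
    (hmove : ∃ᶠ x in L, ∃ g ∈ S, a g x ≠ x) :
    ∃ f : G → E, (∀ g h, f (g * h) = f g + f h) ∧ ∃ g, f g ≠ 0 := by
  let ρ : E → ℝ := fun x => ∑ g ∈ S, ‖a g x - x‖
  have : NeBot (L ⊓ 𝓟 {x | ∃ g ∈ S, a g x ≠ x}) := frequently_mem_iff_neBot.1 hmove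
  let U : Ultrafilter E := Ultrafilter.of (L ⊓ 𝓟 {x | ∃ g ∈ S, a g x ≠ x})
  have hU : (U : Filter E) ≤ L := (Ultrafilter.of_le _).trans inf_le_left
  have hρ : ∀ᶠ x in (U : Filter E), 0 < ρ x := by
    have : ∀ᶠ x in (U : Filter E), ∃ g ∈ S, a g x ≠ x :=
      (Ultrafilter.of_le _).trans inf_le_right (mem_principal_self _)
    filter_upwards [this] with x ⟨g, hg, hgx⟩
    exact Finset.sum_pos' (fun _ _ => norm_nonneg _) ⟨g, hg, norm_pos_iff.2 (sub_ne_zero.2 hgx)⟩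
  let d : G → E → E := fun g x => a g x - x
  have hcoc : ∀ g h, (fun x => d (g * h) x - d g x - d h x) =o[U] d h := by
    intro g h
    refine IsLittleO.mono (IsLittleO.of_bound fun c hc => ?_) hU
    lift c to NNReal using hc.le
    obtain ⟨t, ht, hLt⟩ := hlip g c (by exact_mod_cast hc)
    filter_upwards [hmul g h, ht, htend h ht] with x h1 h2 h3
    have := hLt.norm_sub_le h3 h2
    have h4 : d (g * h) x - d g x - d h x = a g (a h x) - a h x - (a g x - x) := by
      change a (g * h) x - x - (a g x - x) - (a h x - x) = _
      rw [h1]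
      abel
    rw [h4]
    exact this
  have hbig : ∀ g, d g =O[U] ρ := by
    intro g
    have hg : g ∈ Subgroup.closure (S : Set G) := hS ▸ Subgroup.mem_top g
    induction hg using Subgroup.closure_induction with
    | mem g hg =>
      refine IsBigO.of_bound 1 (Eventually.of_forall fun x => ?_)
      rw [one_mul]
      exact (Finset.single_le_sum (f := fun g => ‖a g x - x‖) (fun _ _ => norm_nonneg _) hg).trans
        (Real.le_norm_self _)
    | one =>
      refine IsBigO.of_bound 1 ((hone.filter_mono hU).mono fun x hx => ?_)
      simp [d, hx]
    | mul g h _ _ hg hh =>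
      refine (((hcoc g h).isBigO.trans hh).add (hg.add hh)).congr_left fun x => ?_
      abel
    | inv g _ hg =>
      have h1 : d (g⁻¹ * g) =ᶠ[U] 0 := by
        rw [inv_mul_cancel]
        filter_upwards [hone.filter_mono hU] with x hx
        simp [d, hx]
      refine (((hcoc g⁻¹ g).isBigO.trans hg).add hg).neg_left.congr' ?_ EventuallyEq.rfl
      filter_upwards [h1] with x hx
      rw [hx]
      simp
  have hlim : ∀ g, ∃ v, Tendsto (fun x => (ρ x)⁻¹ • d g x) U (𝓝 v) := by
    intro g
    obtain ⟨C, hC⟩ := (hbig g).bound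
    have hmem : Metric.closedBall (0 : E) C ∈ U.map fun x => (ρ x)⁻¹ • d g x := by
      rw [Ultrafilter.mem_map]
      filter_upwards [hC, hρ] with x hx hpos
      rw [Set.mem_preimage, mem_closedBall_zero_iff, norm_smul, norm_inv,
        inv_mul_le_iff₀ (norm_pos_iff.2 hpos.ne'), mul_comm]
      exact hx
    obtain ⟨v, -, hv⟩ := (isCompact_closedBall (0 : E) C).ultrafilter_le_nhds' _ hmem
    exact ⟨v, hv⟩
  choose f hf using hlim
  refine ⟨f, fun g h => ?_, ?_⟩
  · have h0 : Tendsto (fun x => (ρ x)⁻¹ • (d (g * h) x - d g x - d h x)) U (𝓝 0) := by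
      have : (fun x => d (g * h) x - d g x - d h x) =o[U] ρ := (hcoc g h).trans_isBigO (hbig h)
      rw [tendsto_zero_iff_norm_tendsto_zero]
      refine this.norm_left.norm_right.tendsto_div_nhds_zero.congr fun x => ?_
      rw [norm_smul, norm_inv, div_eq_inv_mul]
    have h1 := ((hf (g * h)).sub (hf g)).sub (hf h)
    simp only [← smul_sub] at h1
    have := tendsto_nhds_unique h1 h0
    rw [sub_sub, sub_eq_zero] at this
    exact this
  · by_contra! hzero
    have h1 : Tendsto (fun x => ∑ g ∈ S, ‖(ρ x)⁻¹ • d g x‖) U (𝓝 (∑ g ∈ S, ‖f g‖)) :=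
      tendsto_finsetSum _ fun g _ => (hf g).norm
    have h2 : (fun x => ∑ g ∈ S, ‖(ρ x)⁻¹ • d g x‖) =ᶠ[U] fun _ => (1 : ℝ) := by
      filter_upwards [hρ] with x hx
      simp only [norm_smul, norm_inv, ← Finset.mul_sum]
      rw [Real.norm_of_nonneg hx.le]
      exact inv_mul_cancel₀ hx.ne'
    have := tendsto_nhds_unique (h1.congr' h2) tendsto_const_nhds
    simp [hzero] at this

end Thurston

section Action

open Filter

variable {E : Type*} [NormedAddCommGroup E] [NormedSpace ℝ E]
  {H : Type*} [TopologicalSpace H] {I : ModelWithCorners ℝ E H}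
  {M : Type*} [TopologicalSpace M] [ChartedSpace H M]

variable (I) in
/-- A self-map of a manifold read in the preferred chart at `p`, both in the source and in the
target. -/
noncomputable def chartRead (p : M) (f : M → M) : E → E :=
  extChartAt I p ∘ f ∘ (extChartAt I p).symm

variable (I) in
/-- The derivative at `p` of a self-map fixing `p`, as an endomorphism of the model space. -/
noncomputable def chartDeriv (p : M) (f : M → M) : E →L[ℝ] E := mfderiv I I f p

theorem chartRead_contDiffWithinAt [IsManifold I 1 M] {f : M → M} (hf : ContMDiff I I 1 f) {p : M}
    (hp : f p = p) : ContDiffWithinAt ℝ 1 (chartRead I p f) (Set.range I) (extChartAt I p p) := by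
  have := (contMDiffAt_iff.1 (hf p)).2
  rwa [hp] at this

theorem fderivWithin_chartRead [IsManifold I 1 M] {f : M → M} (hf : ContMDiff I I 1 f) {p : M}
    (hp : f p = p) :
    fderivWithin ℝ (chartRead I p f) (Set.range I) (extChartAt I p p) = chartDeriv I p f := by
  have h1 : chartDeriv I p f
      = fderivWithin ℝ (writtenInExtChartAt I I p f) (Set.range I) (extChartAt I p p) :=
    (hf.mdifferentiable one_ne_zero p).mfderiv
  rw [h1, writtenInExtChartAt, hp, chartRead]

theorem chartDeriv_comp {f g : M → M} (hf : MDifferentiable I I f) (hg : MDifferentiable I I g)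
    {p : M} (hp : g p = p) : chartDeriv I p (f ∘ g) = (chartDeriv I p f).comp (chartDeriv I p g) := by
  have key : ∀ q, q = p → (mfderiv I I f q : E →L[ℝ] E) = mfderiv I I f p := by
    rintro _ rfl; rfl
  unfold chartDeriv
  rw [← key (g p) hp]
  exact mfderiv_comp p (hf (g p)) (hg p)

/-- The derivative of a map fixing the image of `ι` pointwise fixes the image of the derivative
of `ι` pointwise. -/
theorem chartDeriv_apply_mfderiv {E' : Type*} [NormedAddCommGroup E'] [NormedSpace ℝ E']
    {H' : Type*} [TopologicalSpace H'] {I' : ModelWithCorners ℝ E' H'}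
    {N : Type*} [TopologicalSpace N] [ChartedSpace H' N] {ι : N → M} (hι : MDifferentiable I' I ι)
    {f : M → M} (hf : MDifferentiable I I f) (hfix : ∀ x, f (ι x) = ι x) (x : N) (v : E') :
    chartDeriv I (ι x) f ((mfderiv I' I ι x : E' →L[ℝ] E) v)
      = (mfderiv I' I ι x : E' →L[ℝ] E) v := by
  have key : ∀ k : N → M, k = ι →
      (mfderiv I' I k x : E' →L[ℝ] E) = (mfderiv I' I ι x : E' →L[ℝ] E) := by
    rintro _ rfl; rfl
  have h1 : (mfderiv I' I (f ∘ ι) x : E' →L[ℝ] E)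
      = (chartDeriv I (ι x) f).comp (mfderiv I' I ι x : E' →L[ℝ] E) :=
    mfderiv_comp x (hf (ι x)) (hι x)
  rw [key (f ∘ ι) (funext hfix)] at h1
  exact (congrArg (fun A : E' →L[ℝ] E => A v) h1).symm

theorem tendsto_chartRead {f : M → M} (hf : Continuous f) {p : M} (hp : f p = p) :
    Tendsto (chartRead I p f) (𝓝[Set.range I] extChartAt I p p)
      (𝓝[Set.range I] extChartAt I p p) := by
  have h : Tendsto f (𝓝 p) (𝓝 p) := by simpa [hp] using hf.tendsto p
  rw [← map_extChartAt_nhds p, tendsto_map'_iff]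
  refine (tendsto_map.comp h).congr' ?_
  filter_upwards [extChartAt_source_mem_nhds (I := I) p] with y hy
  simp only [chartRead, Function.comp_apply]
  rw [(extChartAt I p).left_inv hy]

theorem chartRead_comp {f g : M → M} (hg : Continuous g) {p : M} (hp : g p = p) :
    ∀ᶠ x in 𝓝[Set.range I] extChartAt I p p,
      chartRead I p (f ∘ g) x = chartRead I p f (chartRead I p g x) := by
  have h : Tendsto g (𝓝 p) (𝓝 p) := by simpa [hp] using hg.tendsto p
  rw [← map_extChartAt_nhds p, eventually_map]
  filter_upwards [extChartAt_source_mem_nhds (I := I) p,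
    h (extChartAt_source_mem_nhds (I := I) p)] with y hy hgy
  simp only [chartRead, Function.comp_apply]
  rw [(extChartAt I p).left_inv hy, (extChartAt I p).left_inv hgy]

theorem chartRead_apply_eq_iff {f : M → M} (hf : Continuous f) {p : M} (hp : f p = p) :
    ∀ᶠ y in 𝓝 p, chartRead I p f (extChartAt I p y) = extChartAt I p y ↔ f y = y := by
  have h : Tendsto f (𝓝 p) (𝓝 p) := by simpa [hp] using hf.tendsto p
  filter_upwards [extChartAt_source_mem_nhds (I := I) p,
    h (extChartAt_source_mem_nhds (I := I) p)] with y hy hfy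
  simp only [chartRead, Function.comp_apply]
  rw [(extChartAt I p).left_inv hy]
  exact (extChartAt I p).injOn.eq_iff hfy hy

/-- A `C^1` map agreeing with the identity on an open set has identity derivative at the fixed
points of its closure. -/
theorem chartDeriv_eq_id_of_mem_closure [IsManifold I 1 M] {f : M → M} (hf : ContMDiff I I 1 f)
    {p : M} (hp : f p = p) {U : Set M} (hU : IsOpen U) (hfU : ∀ x ∈ U, f x = x)
    (hpU : p ∈ closure U) : chartDeriv I p f = ContinuousLinearMap.id ℝ E := by
  set A := chartDeriv I p f
  by_contra hne
  obtain ⟨v, hv⟩ : ∃ v, A v ≠ v := by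
    by_contra! h
    exact hne (ContinuousLinearMap.ext h)
  obtain ⟨ε, hε, hεv⟩ : ∃ ε : NNReal, 0 < ε ∧ ε * ‖v‖ < ‖v - A v‖ := by
    have h1 : 0 < ‖v - A v‖ := norm_pos_iff.2 (sub_ne_zero.2 hv.symm)
    have h2 : 0 < ‖v‖ := norm_pos_iff.2 fun h => hv (by simp [h])
    refine ⟨⟨‖v - A v‖ / (2 * ‖v‖), by positivity⟩, ?_, ?_⟩
    · exact (by positivity : (0 : ℝ) < ‖v - A v‖ / (2 * ‖v‖))
    · change ‖v - A v‖ / (2 * ‖v‖) * ‖v‖ < _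
      have : ‖v - A v‖ / (2 * ‖v‖) * ‖v‖ = ‖v - A v‖ / 2 := by field_simp
      linarith
  have hx0 : extChartAt I p p ∈ Set.range I := extChartAt_target_subset_range p (mem_extChartAt_target p)
  obtain ⟨t, ht, hLt⟩ := exists_lipschitzOnWith_sub_of_contDiffWithinAt I.convex_range hx0
    (I.uniqueDiffOn _ hx0) (chartRead_contDiffWithinAt hf hp) (fderivWithin_chartRead hf hp) hε
  rw [← map_extChartAt_nhds p, mem_map] at ht
  obtain ⟨y, ⟨hyt, hys⟩, hyU⟩ := mem_closure_iff_nhds.1 hpU _ (inter_mem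
    (interior_mem_nhds.2 ht) (extChartAt_source_mem_nhds (I := I) p))
  have hW : ∀ᶠ z in 𝓝[Set.range I] extChartAt I p y, z ∈ t ∧ chartRead I p f z = z := by
    rw [← map_extChartAt_nhds' hys, eventually_map]
    filter_upwards [mem_interior_iff_mem_nhds.1 hyt, hU.mem_nhds hyU,
      extChartAt_source_mem_nhds' (I := I) hys] with z hz hzU hzs
    refine ⟨hz, ?_⟩
    simp only [chartRead, Function.comp_apply]
    rw [(extChartAt I p).left_inv hzs, hfU z hzU]
  obtain ⟨O, hO, hyO, hOW⟩ := mem_nhdsWithin.1 hW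
  have hyI : extChartAt I p y ∈ Set.range I :=
    extChartAt_target_subset_range p ((extChartAt I p).map_source hys)
  obtain ⟨w, hwO, hwI⟩ := mem_closure_iff_nhds.1 (I.range_subset_closure_interior hyI) O
    (hO.mem_nhds hyO)
  have hwnhds : O ∩ Set.range I ∈ 𝓝 w :=
    inter_mem (hO.mem_nhds hwO) (mem_interior_iff_mem_nhds.1 hwI)
  have hline : Tendsto (fun r : ℝ => w + r • v) (𝓝[>] 0) (𝓝 w) := by
    have : Tendsto (fun r : ℝ => w + r • v) (𝓝 0) (𝓝 (w + (0 : ℝ) • v)) :=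
      Continuous.tendsto (by fun_prop) 0
    rw [zero_smul, add_zero] at this
    exact this.mono_left nhdsWithin_le_nhds
  obtain ⟨r, hr, hr0⟩ := ((hline.eventually hwnhds).and self_mem_nhdsWithin).exists
  replace hr0 : 0 < r := hr0
  obtain ⟨h1, h2⟩ := hOW hr
  obtain ⟨h3, h4⟩ := hOW (mem_of_mem_nhds hwnhds)
  have h5 := hLt.norm_sub_le h1 h3
  rw [h2, h4, map_add, map_smul, add_sub_cancel_left, norm_smul, Real.norm_of_nonneg hr0.le] at h5
  have h6 : w + r • v - (A w + r • A v) - (w - A w) = r • (v - A v) := by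
    rw [smul_sub]; abel
  rw [h6, norm_smul, Real.norm_of_nonneg hr0.le] at h5
  nlinarith

/-- Thurston stability: a finitely generated group of `C^1` diffeomorphisms fixing `p` with
identity derivatives at `p`, but not fixing a neighborhood of `p`, has a nontrivial homomorphism
to the model space. -/
theorem exists_additive_of_notMem_interior_fixedPoints [FiniteDimensional ℝ E] [IsManifold I 1 M]
    {G : Type*} [Group G] [hG : Group.FG G] (ρ : G →* (M ≃ₘ^1⟮I, I⟯ M)) {p : M}
    (hp : ∀ g, ρ g p = p) (hd : ∀ g, chartDeriv I p (ρ g) = ContinuousLinearMap.id ℝ E)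
    (hint : p ∉ interior {x | ∀ g, ρ g x = x}) :
    ∃ f : G → E, (∀ g h, f (g * h) = f g + f h) ∧ ∃ g, f g ≠ 0 := by
  obtain ⟨S, hS⟩ := Group.fg_def.1 hG
  have hx0 : extChartAt I p p ∈ Set.range I :=
    extChartAt_target_subset_range p (mem_extChartAt_target p)
  refine exists_additive_of_tangent_to_identity (L := 𝓝[Set.range I] extChartAt I p p) S hS
    (fun g => chartRead I p (ρ g)) ?_ ?_ ?_ ?_ ?_
  · filter_upwards [extChartAt_target_mem_nhdsWithin (I := I) p] with x hx
    have : ((ρ 1 : M ≃ₘ^1⟮I, I⟯ M) : M → M) = id := by rw [map_one]; rfl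
    rw [this]
    exact (extChartAt I p).right_inv hx
  · intro g h
    have : ((ρ (g * h) : M ≃ₘ^1⟮I, I⟯ M) : M → M) = ρ g ∘ ρ h := by rw [map_mul]; rfl
    rw [this]
    exact chartRead_comp (ρ h).continuous (hp h)
  · exact fun g => tendsto_chartRead (ρ g).continuous (hp g)
  · intro g ε hε
    exact exists_lipschitzOnWith_sub_of_contDiffWithinAt I.convex_range hx0
      (I.uniqueDiffOn _ hx0) (chartRead_contDiffWithinAt (ρ g).contMDiff_toFun (hp g))
      ((fderivWithin_chartRead (ρ g).contMDiff_toFun (hp g)).trans (hd g)) hε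
  · intro hcon
    apply hint
    rw [mem_interior_iff_mem_nhds]
    rw [← map_extChartAt_nhds p, eventually_map] at hcon
    have h1 : ∀ᶠ y in 𝓝 p, ∀ g ∈ S,
        chartRead I p (ρ g) (extChartAt I p y) = extChartAt I p y ↔ ρ g y = y :=
      (eventually_all_finset S).2 fun g _ => chartRead_apply_eq_iff (ρ g).continuous (hp g)
    filter_upwards [hcon, h1] with y hy hy1 g
    push Not at hy
    have hg : g ∈ Subgroup.closure (S : Set G) := hS ▸ Subgroup.mem_top g
    induction hg using Subgroup.closure_induction with
    | mem g hg => exact (hy1 g hg).1 (hy g hg)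
    | one => rw [map_one]; rfl
    | mul g h _ _ hg hh => rw [map_mul, diffeomorph_mul_apply, hh, hg]
    | inv g _ hg =>
      rw [map_inv]
      conv_lhs => rw [← hg]
      exact diffeomorph_inv_apply_self _ y

end Action

section Main

variable {E : Type*} [NormedAddCommGroup E] [NormedSpace ℝ E] [FiniteDimensional ℝ E]
  {H : Type*} [TopologicalSpace H] {I : ModelWithCorners ℝ E H}
  {M : Type*} [TopologicalSpace M] [ChartedSpace H M] [IsManifold I 1 M]

theorem det_chartDeriv_pos (o : ManifoldOrientation I M) {f : M ≃ₘ^1⟮I, I⟯ M}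
    (hf : o.IsPreservedBy f) {p : M} (hp : f p = p) :
    0 < LinearMap.det (chartDeriv I p f : E →ₗ[ℝ] E) := by
  have key : ∀ q, q = p →
      (o.orientationAt q : Orientation ℝ E (Fin (Module.finrank ℝ E))) = o.orientationAt p := by
    rintro _ rfl; rfl
  let e : E ≃ₗ[ℝ] E := (f.mfderivToContinuousLinearEquiv one_ne_zero p).toLinearEquiv
  let u : Orientation ℝ E (Fin (Module.finrank ℝ E)) := o.orientationAt p
  have h : Orientation.map _ e u = u := (hf p).trans (key _ hp)
  exact (Orientation.map_eq_iff_det_pos u e (by simp)).1 h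

/-- Orientation-preserving `C^1` diffeomorphisms of a connected manifold fixing an immersed
hypersurface pointwise form a locally indicable group. -/
theorem locallyIndicable_orientedDiffFixing_range [T2Space M] [ConnectedSpace M]
    {E' : Type*} [NormedAddCommGroup E'] [NormedSpace ℝ E'] [FiniteDimensional ℝ E']
    (hE' : Module.finrank ℝ E' + 1 = Module.finrank ℝ E)
    {H' : Type*} [TopologicalSpace H'] {I' : ModelWithCorners ℝ E' H'}
    {N : Type*} [TopologicalSpace N] [Nonempty N] [ChartedSpace H' N]
    {ι : N → M} (hι : MDifferentiable I' I ι)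
    (hι_imm : ∀ x : N, Function.Injective (mfderiv I' I ι x)) (o : ManifoldOrientation I M) :
    LocallyIndicable (orientedDiffFixing o (Set.range ι)) := by
  intro S hSfg hS
  have : Group.FG S := (Group.fg_iff_subgroup_fg S).2 hSfg
  let ρ : S →* (M ≃ₘ^1⟮I, I⟯ M) := (orientedDiffFixing o (Set.range ι)).subtype.comp S.subtype
  have hpres : ∀ g, o.IsPreservedBy (ρ g) := fun g => g.1.2.1
  have hfix : ∀ g x, ρ g (ι x) = ι x := fun g x => g.1.2.2 _ ⟨x, rfl⟩
  have hdiff : ∀ g, MDifferentiable I I (ρ g) := fun g => (ρ g).mdifferentiable one_ne_zero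
  by_cases hlin : ∃ x g, chartDeriv I (ι x) (ρ g) ≠ ContinuousLinearMap.id ℝ E
  · obtain ⟨x, g, hg⟩ := hlin
    let B : E' →L[ℝ] E := mfderiv I' I ι x
    have hBinj : Function.Injective (B : E' →ₗ[ℝ] E) := hι_imm x
    have hmul : ∀ g h, (chartDeriv I (ι x) (ρ (g * h)) : E →ₗ[ℝ] E)
        = (chartDeriv I (ι x) (ρ g) : E →ₗ[ℝ] E) ∘ₗ (chartDeriv I (ι x) (ρ h) : E →ₗ[ℝ] E) := by
      intro g h
      have h1 : ((ρ (g * h) : M ≃ₘ^1⟮I, I⟯ M) : M → M) = ρ g ∘ ρ h := by rw [map_mul]; rfl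
      rw [h1, chartDeriv_comp (hdiff g) (hdiff h) (hfix h x)]
      rfl
    have hrange : ∀ g, ∀ w ∈ LinearMap.range (B : E' →ₗ[ℝ] E),
        (chartDeriv I (ι x) (ρ g) : E →ₗ[ℝ] E) w = w := by
      rintro g _ ⟨v, rfl⟩
      exact chartDeriv_apply_mfderiv hι (hdiff g) (hfix g) x v
    rcases exists_additive_of_fixes_hyperplane
      (fun g : S => (chartDeriv I (ι x) (ρ g) : E →ₗ[ℝ] E)) hmul
      (fun g => det_chartDeriv_pos o (hpres g) (hfix g x)) (LinearMap.range (B : E' →ₗ[ℝ] E))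
      (by rw [LinearMap.finrank_range_of_inj hBinj, hE']) hrange (g₀ := g)
      (fun h => hg (ContinuousLinearMap.coe_injective h)) with
      ⟨f, hf, k, hk⟩ | ⟨f, hf, k, hk⟩
    · exact exists_surjective_hom_int_of_hom_ne_zero f hf hk
    · exact exists_surjective_hom_int_of_hom_ne_zero f hf hk
  push Not at hlin
  set U : Set M := interior {x | ∀ g, ρ g x = x} with hU
  have hUfix : ∀ x ∈ U, ∀ g, ρ g x = x := fun x hx => interior_subset hx
  suffices ∃ p, p ∉ U ∧ (∀ g, ρ g p = p) ∧
      ∀ g, chartDeriv I p (ρ g) = ContinuousLinearMap.id ℝ E by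
    obtain ⟨p, hpU, hp, hd⟩ := this
    obtain ⟨f, hf, k, hk⟩ := exists_additive_of_notMem_interior_fixedPoints ρ hp hd hpU
    exact exists_surjective_hom_int_of_hom_ne_zero f hf hk
  by_cases hKU : ∃ x, ι x ∉ U
  · obtain ⟨x, hx⟩ := hKU
    exact ⟨ι x, hx, fun g => hfix g x, hlin x⟩
  push Not at hKU
  have hUne : U.Nonempty := ⟨_, hKU (Classical.arbitrary N)⟩
  have hUuniv : U ≠ Set.univ := by
    intro h
    refine hS ((Subgroup.eq_bot_iff_forall S).2 fun g hg => ?_)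
    refine Subtype.ext (Diffeomorph.ext fun x => ?_)
    exact hUfix x (h ▸ Set.mem_univ x) ⟨g, hg⟩
  obtain ⟨p, hp⟩ := (nonempty_frontier_iff.2 ⟨hUne, hUuniv⟩ : (frontier U).Nonempty)
  have hUo : IsOpen U := isOpen_interior
  rw [hUo.frontier_eq] at hp
  have hfixp : ∀ g, ρ g p = p := fun g => by
    have hcl : IsClosed {x | ρ g x = x} := isClosed_eq (ρ g).continuous continuous_id
    exact closure_minimal (fun x hx => hUfix x hx g) hcl hp.1
  exact ⟨p, hp.2, hfixp, fun g => chartDeriv_eq_id_of_mem_closure (ρ g).contMDiff_toFun (hfixp g)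
    hUo (fun x hx => hUfix x hx g) hp.1⟩

end Main

theorem mainTheorem4
    -- a connected smooth manifold `M` of dimension `n` (boundary and corners are allowed)
    (n : ℕ)
    {E : Type*} [NormedAddCommGroup E] [NormedSpace ℝ E] [FiniteDimensional ℝ E]
    (hE : Module.finrank ℝ E = n)
    {H : Type*} [TopologicalSpace H] (I : ModelWithCorners ℝ E H)
    {M : Type*} [TopologicalSpace M] [T2Space M] [ConnectedSpace M]
    [ChartedSpace H M] [IsManifold I ∞ M]
    -- a nonempty smooth manifold `N` of dimension `n - 1`
    {E' : Type*} [NormedAddCommGroup E'] [NormedSpace ℝ E'] [FiniteDimensional ℝ E']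
    (hE' : Module.finrank ℝ E' + 1 = n)
    {H' : Type*} [TopologicalSpace H'] (I' : ModelWithCorners ℝ E' H')
    {N : Type*} [TopologicalSpace N] [Nonempty N] [ChartedSpace H' N] [IsManifold I' ∞ N]
    -- a smooth embedding of `N` in `M` as the closed submanifold `K`
    (ι : N → M) (hι : ContMDiff I' I ∞ ι) (hι_closed : Topology.IsClosedEmbedding ι)
    (hι_imm : ∀ x : N, Function.Injective (mfderiv I' I ι x))
    (K : Set M) (hK : K = Set.range ι)
    -- an orientation of `M`
    (o : ManifoldOrientation I M) :
    LocallyIndicable (orientedDiffFixing o K) ∧ LeftOrderable (orientedDiffFixing o K) := by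
  subst hK hE
  have h := locallyIndicable_orientedDiffFixing_range hE' (hι.mdifferentiable (by simp)) hι_imm o
  exact ⟨h, h.leftOrderable⟩
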